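/- Let $d\in\{2,3\}$, let $\Omega\subset\mathbb{R}^d$ be a bounded open set whose closure is triangulated by a finite conforming triangulation $\mathcal{T}$ into $d$-simplices (in particular, $\Omega$ may be a polyhedral Lipschitz domain), and let $\mathbf f\in L^2(\Omega)^d$, $\sigma\ge 0$, $\nu>0$ and $n\in\{1,2,\dots\}$. The space $W_0^{1,2}(\Omega)^d$ is the closure of $C_0^\infty(\Omega)^d$ in $W^{1,2}(\Omega)^d$, with the norm $\|\mathbf v\|_{1,2}:=\|\nabla\mathbf v\|_{L^2(\Omega)}$. For polynomial spaces with $\mathbb P_1^d\subseteq\mathbb P_{\mathbb V}(K)\subseteq\mathbb P_{i^\star}^d$ and $\mathbb P_0\subseteq\mathbb P_{\mathbb Q}(K)\subseteq\mathbb P_{j^\star}$ ($K\in\mathcal T$, $i^\star\ge j^\star\ge 0$) put $$\mathbb V:=\{\mathbf V\in W_0^{1,2}(\Omega)^d:\mathbf V|_K\in\mathbb P_{\mathbb V}(K)\ \forall K\in\mathcal T\},\quad \mathbb Q:=\{Q\in L^\infty(\Omega):Q|_K\in\mathbb P_{\mathbb Q}(K)\ \forall K\in\mathcal T\},\quad \mathbb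 Q_0:=\Big\{Q\in\mathbb Q:\int_\Omega Q\,dx=0\Big\}.$$ With $\mathrm D\mathbf V:=\frac12(\nabla\mathbf V+(\nabla\mathbf V)^{\mathrm T})$ and the Frobenius inner product and norm, let $$a_n(\mathbf U;\mathbf V,\mathbf W):=\int_\Omega\Big(\frac{\sigma}{\sqrt{|\mathrm D\mathbf U|^2+n^{-2}}}+2\nu\Big)\mathrm D\mathbf V:\mathrm D\mathbf W\,dx,\qquad b(Q,\mathbf V):=-\int_\Omega Q\,\mathrm{div}\,\mathbf V\,dx .$$ Let $(\mathbf U,P)\in\mathbb V\times\mathbb Q_0$ solve the regularised convection-free discrete Bingham problem $$a_n(\mathbf U;\mathbf U,\mathbf V)+b(P,\mathbf V)+b(Q,\mathbf U)=\int_\Omega\mathbf f\cdot\mathbf V\,dx\qquad\text{for all }(\mathbf V,Q)\in\mathbb V\times\mathbb Q,$$ and let $(\mathbf U^\ell)_{\ell\ge 0}$ be generated by the Kačanov iteration: $\mathbf U^0\in\mathbb V$ is arbitrary and, for $\ell=0,1,2,\dots$, $(\mathbf U^{\ell+1},P^{\ell+1})\in\mathbb V\times\mathbb Q_0$ satisfies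 $$a_n(\mathbf U^\ell;\mathbf U^{\ell+1},\mathbf V)+b(P^{\ell+1},\mathbf V)+b(Q,\mathbf U^{\ell+1})=\int_\Omega\mathbf f\cdot\mathbf V\,dx\qquad\text{for all }(\mathbf V,Q)\in\mathbb V\times\mathbb Q.$$ Then $$q_{\rm con}:=1-\frac{\nu^3}{(\sqrt3\,\sigma n+2\nu)(\sigma n+2\nu)^2}\in(0,1),$$ $$\|\mathbf U-\mathbf U^\ell\|_{1,2}\le\sqrt{\frac{\sqrt3\,\sigma n+2\nu}{\nu}}\;q_{\rm con}^{\ell/2}\,\|\mathbf U-\mathbf U^0\|_{1,2}\qquad\text{for all }\ell=0,1,2,\dots,$$ and consequently $\|\mathbf U-\mathbf U^\ell\|_{1,2}\to 0$ as $\ell\to\infty$. -/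

import Mathlib

open MeasureTheory Filter Topology

noncomputable section

namespace KacanovFE

/-- Points and vectors of `ℝ^d`, with the Euclidean norm. -/
abbrev Vec (d : ℕ) := EuclideanSpace ℝ (Fin d)

/-- Real `d × d` matrices; the norm and the inner product are the Frobenius ones. The entry
`(i, j)` of a velocity gradient is the `j`-th partial derivative of the `i`-th component. -/
abbrev Mat (d : ℕ) := EuclideanSpace ℝ (Fin d × Fin d)

/-- The symmetric part `(G + Gᵀ) / 2` of a matrix. -/
def sym {d : ℕ} (G : Mat d) : Mat d :=
  WithLp.toLp 2 fun p => (G p + G p.swap) / 2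

/-- The trace of a matrix; the trace of a velocity gradient is the divergence. -/
def tr {d : ℕ} (G : Mat d) : ℝ := ∑ i, G (i, i)

/-- The Lebesgue space `L²(Ω)^d`. -/
abbrev L2Vec {d : ℕ} (Ω : Set (Vec d)) := Lp (Vec d) 2 (volume.restrict Ω)

/-- Pairs `(v, G)` of a square integrable vector field and a square integrable matrix field
on `Ω`. A Sobolev function is represented by the pair of itself and its weak gradient. -/
abbrev Pair {d : ℕ} (Ω : Set (Vec d)) :=
  Lp (Vec d) 2 (volume.restrict Ω) × Lp (Mat d) 2 (volume.restrict Ω)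

/-- `φ ∈ C_0^∞(Ω; F)`: smooth, with compact support contained in `Ω`. -/
def IsTest {d : ℕ} {F : Type*} [NormedAddCommGroup F] [NormedSpace ℝ F]
    (Ω : Set (Vec d)) (φ : Vec d → F) : Prop :=
  ContDiff ℝ (⊤ : ℕ∞) φ ∧ HasCompactSupport φ ∧ tsupport φ ⊆ Ω

/-- `G` is the weak (distributional) gradient of `v` on `Ω`. -/
def HasWeakGradient {d : ℕ} (Ω : Set (Vec d)) (v : Vec d → Vec d) (G : Vec d → Mat d) : Prop :=
  ∀ φ : Vec d → ℝ, IsTest Ω φ → ∀ i j : Fin d,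
    ∫ x in Ω, v x i * fderiv ℝ φ x (EuclideanSpace.single j 1) = - ∫ x in Ω, G x (i, j) * φ x

/-- The classical gradient (Jacobian matrix) of a vector field. -/
def classicalGrad {d : ℕ} (φ : Vec d → Vec d) (x : Vec d) : Mat d :=
  WithLp.toLp 2 fun p => fderiv ℝ φ x (EuclideanSpace.single p.2 1) p.1

lemma integrable_coord_mul {d : ℕ} {ι : Type*} [Fintype ι] {Ω : Set (Vec d)}
    (v : Lp (EuclideanSpace ℝ ι) 2 (volume.restrict Ω)) (i : ι) {ψ : Vec d → ℝ}
    (hc : Continuous ψ) (hs : HasCompactSupport ψ) :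
    Integrable (fun x => v x i * ψ x) (volume.restrict Ω) := by
  have h1 : MemLp (fun x => v x i) 2 (volume.restrict Ω) :=
    (Lp.memLp v).continuousLinearMap_comp (EuclideanSpace.proj (𝕜 := ℝ) i)
  have h2 : MemLp ψ 2 (volume.restrict Ω) := (hc.memLp_of_hasCompactSupport hs)
  exact h1.integrable_mul h2

lemma continuous_partial {d : ℕ} {Ω : Set (Vec d)} {φ : Vec d → ℝ} (hφ : IsTest Ω φ)
    (e : Vec d) : Continuous fun x => fderiv ℝ φ x e :=
  (hφ.1.continuous_fderiv (by simp)).clm_apply continuous_const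

lemma hasCompactSupport_partial {d : ℕ} {Ω : Set (Vec d)} {φ : Vec d → ℝ} (hφ : IsTest Ω φ)
    (e : Vec d) : HasCompactSupport fun x => fderiv ℝ φ x e :=
  hφ.2.1.fderiv_apply (𝕜 := ℝ) e

/-- The Sobolev space `W^{1,2}(Ω)^d`: pairs `(v, ∇v)` with `v` and its weak gradient `∇v`
square integrable. -/
def sobolev {d : ℕ} (Ω : Set (Vec d)) : Submodule ℝ (Pair Ω) where
  carrier := {w | HasWeakGradient Ω w.1 w.2}
  zero_mem' := by
    intro φ hφ i j
    have h1 : ∫ x in Ω, (0 : Lp (Vec d) 2 (volume.restrict Ω)) x i *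
        fderiv ℝ φ x (EuclideanSpace.single j 1) = ∫ x in Ω, (0 : ℝ) := by
      refine integral_congr_ae ?_
      filter_upwards [Lp.coeFn_zero (Vec d) 2 (volume.restrict Ω)] with x hx
      have hx' : ((0 : Lp (Vec d) 2 (volume.restrict Ω)) : Vec d → Vec d) x = 0 := hx
      rw [hx']
      simp
    have h2 : ∫ x in Ω, (0 : Lp (Mat d) 2 (volume.restrict Ω)) x (i, j) * φ x
        = ∫ x in Ω, (0 : ℝ) := by
      refine integral_congr_ae ?_
      filter_upwards [Lp.coeFn_zero (Mat d) 2 (volume.restrict Ω)] with x hx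
      have hx' : ((0 : Lp (Mat d) 2 (volume.restrict Ω)) : Vec d → Mat d) x = 0 := hx
      rw [hx']
      simp
    exact h1.trans (by rw [integral_zero, ← neg_eq_zero.mpr (h2.trans (integral_zero _ _))]; rfl)
  add_mem' := by
    intro a b ha hb φ hφ i j
    have h1 : ∫ x in Ω, (a + b).1 x i * fderiv ℝ φ x (EuclideanSpace.single j 1)
        = (∫ x in Ω, a.1 x i * fderiv ℝ φ x (EuclideanSpace.single j 1)) +
          ∫ x in Ω, b.1 x i * fderiv ℝ φ x (EuclideanSpace.single j 1) := by
      rw [← integral_add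
        (integrable_coord_mul a.1 i (continuous_partial hφ _) (hasCompactSupport_partial hφ _))
        (integrable_coord_mul b.1 i (continuous_partial hφ _) (hasCompactSupport_partial hφ _))]
      refine integral_congr_ae ?_
      filter_upwards [Lp.coeFn_add a.1 b.1] with x hx
      have hx' : (a + b).1 x = a.1 x + b.1 x := hx
      rw [hx', PiLp.add_apply, add_mul]
    have h2 : ∫ x in Ω, (a + b).2 x (i, j) * φ x
        = (∫ x in Ω, a.2 x (i, j) * φ x) + ∫ x in Ω, b.2 x (i, j) * φ x := by
      rw [← integral_add
        (integrable_coord_mul a.2 (i, j) hφ.1.continuous hφ.2.1)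
        (integrable_coord_mul b.2 (i, j) hφ.1.continuous hφ.2.1)]
      refine integral_congr_ae ?_
      filter_upwards [Lp.coeFn_add a.2 b.2] with x hx
      have hx' : (a + b).2 x = a.2 x + b.2 x := hx
      rw [hx', PiLp.add_apply, add_mul]
    rw [h1, h2, ha φ hφ i j, hb φ hφ i j]
    ring
  smul_mem' := by
    intro c a ha φ hφ i j
    have h1 : ∫ x in Ω, (c • a).1 x i * fderiv ℝ φ x (EuclideanSpace.single j 1)
        = c * ∫ x in Ω, a.1 x i * fderiv ℝ φ x (EuclideanSpace.single j 1) := by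
      rw [← integral_const_mul]
      refine integral_congr_ae ?_
      filter_upwards [Lp.coeFn_smul c a.1] with x hx
      simp [hx, mul_assoc]
    have h2 : ∫ x in Ω, (c • a).2 x (i, j) * φ x = c * ∫ x in Ω, a.2 x (i, j) * φ x := by
      rw [← integral_const_mul]
      refine integral_congr_ae ?_
      filter_upwards [Lp.coeFn_smul c a.2] with x hx
      simp [hx, mul_assoc]
    rw [h1, h2, ha φ hφ i j]
    ring

lemma IsTest.add {d : ℕ} {Ω : Set (Vec d)} {φ ψ : Vec d → Vec d} (hφ : IsTest Ω φ)
    (hψ : IsTest Ω ψ) : IsTest Ω (φ + ψ) :=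
  ⟨hφ.1.add hψ.1, hφ.2.1.add hψ.2.1,
    (tsupport_add φ ψ).trans (Set.union_subset hφ.2.2 hψ.2.2)⟩

lemma IsTest.smul {d : ℕ} {Ω : Set (Vec d)} {φ : Vec d → Vec d} (c : ℝ) (hφ : IsTest Ω φ) :
    IsTest Ω (c • φ) :=
  ⟨hφ.1.const_smul c, hφ.2.1.smul_left (f := fun _ => c),
    (tsupport_smul_subset_right (fun _ => c) φ).trans hφ.2.2⟩

/-- The pairs `(φ, ∇φ)` with `φ ∈ C_0^∞(Ω)^d`. -/
def testPairs {d : ℕ} (Ω : Set (Vec d)) : Submodule ℝ (Pair Ω) where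
  carrier := {w | ∃ φ : Vec d → Vec d, IsTest Ω φ ∧
    (w.1 =ᵐ[volume.restrict Ω] φ) ∧ (w.2 =ᵐ[volume.restrict Ω] classicalGrad φ)}
  zero_mem' := by
    refine ⟨0, ⟨contDiff_const, HasCompactSupport.zero, by simp⟩, Lp.coeFn_zero _ _ _, ?_⟩
    filter_upwards [Lp.coeFn_zero (Mat d) 2 (volume.restrict Ω)] with x hx
    have hx' : ((0 : Lp (Mat d) 2 (volume.restrict Ω)) : Vec d → Mat d) x = 0 := hx
    refine hx'.trans ?_
    ext p
    simp [classicalGrad]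
  add_mem' := by
    rintro a b ⟨φ, hφ, ha1, ha2⟩ ⟨ψ, hψ, hb1, hb2⟩
    refine ⟨φ + ψ, hφ.add hψ, ?_, ?_⟩
    · filter_upwards [Lp.coeFn_add a.1 b.1, ha1, hb1] with x hx h1 h2
      have hx' : (a + b).1 x = a.1 x + b.1 x := hx
      rw [hx', h1, h2, Pi.add_apply]
    · filter_upwards [Lp.coeFn_add a.2 b.2, ha2, hb2] with x hx h1 h2
      have e : fderiv ℝ (φ + ψ) x = fderiv ℝ φ x + fderiv ℝ ψ x :=
        fderiv_add (hφ.1.differentiable (by simp) x) (hψ.1.differentiable (by simp) x)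
      have hx' : (a + b).2 x = a.2 x + b.2 x := hx
      rw [hx', h1, h2]
      ext p
      simp [classicalGrad, e]
  smul_mem' := by
    rintro c a ⟨φ, hφ, ha1, ha2⟩
    refine ⟨c • φ, hφ.smul c, ?_, ?_⟩
    · filter_upwards [Lp.coeFn_smul c a.1, ha1] with x hx h1
      simp [hx, h1]
    · filter_upwards [Lp.coeFn_smul c a.2, ha2] with x hx h1
      have e : fderiv ℝ (c • φ) x = c • fderiv ℝ φ x :=
        fderiv_const_smul (hφ.1.differentiable (by simp) x) c
      ext p
      simp [hx, h1, classicalGrad, e]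

/-- `W_0^{1,2}(Ω)^d`: the closure of `C_0^∞(Ω)^d` in `W^{1,2}(Ω)^d`. -/
def sobolevZero {d : ℕ} (Ω : Set (Vec d)) : Submodule ℝ (Pair Ω) :=
  sobolev Ω ⊓ (testPairs Ω).topologicalClosure

/-- The norm `‖v‖_{1,2} = ‖∇v‖_2` of `W_0^{1,2}(Ω)^d`. -/
def norm12 {d : ℕ} {Ω : Set (Vec d)} (v : Pair Ω) : ℝ := ‖v.2‖

/-- `T` is a conforming triangulation of `Ω`: a finite simplicial complex (so two simplices
meet in a common face or not at all), every simplex of which is a face of a `d`-simplex, and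
whose simplices cover exactly the closure of `Ω`. -/
structure IsTriangulation {d : ℕ} (Ω : Set (Vec d))
    (T : Geometry.SimplicialComplex ℝ (Vec d)) : Prop where
  finite : T.faces.Finite
  pure : ∀ s ∈ T.faces, ∃ K ∈ T.faces, s ⊆ K ∧ K.card = d + 1
  space_eq : T.space = closure Ω

/-- The elements of the triangulation: the (vertex sets of the) `d`-simplices. -/
def elements {d : ℕ} (T : Geometry.SimplicialComplex ℝ (Vec d)) : Set (Finset (Vec d)) :=
  {K | K ∈ T.faces ∧ K.card = d + 1}

/-- `ℙ_m`: the real polynomials in `d` variables of total degree at most `m`. -/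
abbrev polys (d m : ℕ) : Submodule ℝ (MvPolynomial (Fin d) ℝ) :=
  MvPolynomial.restrictTotalDegree (Fin d) ℝ m

/-- `ℙ_m^d`: vectors of `d` such polynomials. -/
abbrev vecPolys (d m : ℕ) : Submodule ℝ (Fin d → MvPolynomial (Fin d) ℝ) :=
  Submodule.pi Set.univ fun _ => polys d m

/-- The value of a vector of polynomials at a point. -/
def evalVec {d : ℕ} (p : Fin d → MvPolynomial (Fin d) ℝ) (x : Vec d) : Vec d :=
  WithLp.toLp 2 fun i => MvPolynomial.eval x (p i)

/-- `𝕍(T)`: the functions in `W_0^{1,2}(Ω)^d` whose restriction to each element `K` is in the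
polynomial space `PV K`. -/
def velocitySpace {d : ℕ} (Ω : Set (Vec d)) (T : Geometry.SimplicialComplex ℝ (Vec d))
    (PV : Finset (Vec d) → Submodule ℝ (Fin d → MvPolynomial (Fin d) ℝ)) :
    Submodule ℝ (Pair Ω) where
  carrier := {v | v ∈ sobolevZero Ω ∧ ∀ K ∈ elements T, ∃ p ∈ PV K,
    ∀ᵐ x ∂(volume.restrict Ω), x ∈ convexHull ℝ (K : Set (Vec d)) → v.1 x = evalVec p x}
  zero_mem' := by
    refine ⟨zero_mem _, fun K _ => ⟨0, zero_mem _, ?_⟩⟩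
    filter_upwards [Lp.coeFn_zero (Vec d) 2 (volume.restrict Ω)] with x hx _
    have hx' : ((0 : Lp (Vec d) 2 (volume.restrict Ω)) : Vec d → Vec d) x = 0 := hx
    refine hx'.trans ?_
    ext i
    simp [evalVec]
  add_mem' := by
    rintro a b ⟨ha, ha'⟩ ⟨hb, hb'⟩
    refine ⟨add_mem ha hb, fun K hK => ?_⟩
    obtain ⟨p, hp, h1⟩ := ha' K hK
    obtain ⟨q, hq, h2⟩ := hb' K hK
    refine ⟨p + q, add_mem hp hq, ?_⟩
    filter_upwards [Lp.coeFn_add a.1 b.1, h1, h2] with x hx h1 h2 hxK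
    have hx' : (a + b).1 x = a.1 x + b.1 x := hx
    rw [hx', h1 hxK, h2 hxK]
    ext i
    simp [evalVec]
  smul_mem' := by
    rintro c a ⟨ha, ha'⟩
    refine ⟨Submodule.smul_mem _ c ha, fun K hK => ?_⟩
    obtain ⟨p, hp, h1⟩ := ha' K hK
    refine ⟨c • p, Submodule.smul_mem _ c hp, ?_⟩
    filter_upwards [Lp.coeFn_smul c a.1, h1] with x hx h1 hxK
    ext i
    simp [hx, h1 hxK, evalVec]

/-- The Lebesgue space `L^∞(Ω)`. -/
abbrev LInf {d : ℕ} (Ω : Set (Vec d)) := Lp ℝ ⊤ (volume.restrict Ω)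

/-- `ℚ(T)`: the functions in `L^∞(Ω)` whose restriction to each element `K` is in the
polynomial space `PQ K`. -/
def pressureSpace {d : ℕ} (Ω : Set (Vec d)) (T : Geometry.SimplicialComplex ℝ (Vec d))
    (PQ : Finset (Vec d) → Submodule ℝ (MvPolynomial (Fin d) ℝ)) :
    Submodule ℝ (LInf Ω) where
  carrier := {Q | ∀ K ∈ elements T, ∃ p ∈ PQ K,
    ∀ᵐ x ∂(volume.restrict Ω), x ∈ convexHull ℝ (K : Set (Vec d)) → Q x = MvPolynomial.eval x p}
  zero_mem' := by
    refine fun K _ => ⟨0, zero_mem _, ?_⟩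
    filter_upwards [Lp.coeFn_zero ℝ ⊤ (volume.restrict Ω)] with x hx _
    have hx' : ((0 : Lp ℝ ⊤ (volume.restrict Ω)) : Vec d → ℝ) x = 0 := hx
    exact hx'.trans (map_zero _).symm
  add_mem' := by
    intro a b ha' hb' K hK
    obtain ⟨p, hp, h1⟩ := ha' K hK
    obtain ⟨q, hq, h2⟩ := hb' K hK
    refine ⟨p + q, add_mem hp hq, ?_⟩
    filter_upwards [Lp.coeFn_add a b, h1, h2] with x hx h1 h2 hxK
    have hx' : (a + b : LInf Ω) x = a x + b x := hx
    rw [hx', h1 hxK, h2 hxK, map_add]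
  smul_mem' := by
    intro c a ha' K hK
    obtain ⟨p, hp, h1⟩ := ha' K hK
    refine ⟨c • p, Submodule.smul_mem _ c hp, ?_⟩
    filter_upwards [Lp.coeFn_smul c a, h1] with x hx h1 hxK
    simp [hx, h1 hxK]

/-- `P ∈ ℚ_0(T)`: `P ∈ ℚ(T)` has zero mean value. -/
def IsZeroMeanPressure {d : ℕ} (Ω : Set (Vec d)) (T : Geometry.SimplicialComplex ℝ (Vec d))
    (PQ : Finset (Vec d) → Submodule ℝ (MvPolynomial (Fin d) ℝ)) (P : LInf Ω) : Prop :=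
  P ∈ pressureSpace Ω T PQ ∧ ∫ x in Ω, P x = 0

/-- `a_n(U; V, W) = ∫_Ω (σ / √(|DU|² + n⁻²) + 2ν) DV : DW dx`, where `D` is the symmetric
gradient. -/
def formA {d : ℕ} {Ω : Set (Vec d)} (σ ν : ℝ) (n : ℕ) (U V W : Pair Ω) : ℝ :=
  ∫ x in Ω, (σ / Real.sqrt (‖sym (U.2 x)‖ ^ 2 + ((n : ℝ) ^ 2)⁻¹) + 2 * ν) *
    inner ℝ (sym (V.2 x)) (sym (W.2 x))

/-- `b(Q, V) = -∫_Ω Q div V dx`. -/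
def formB {d : ℕ} {Ω : Set (Vec d)} (Q : LInf Ω) (V : Pair Ω) : ℝ :=
  - ∫ x in Ω, Q x * tr (V.2 x)

/-- `∫_Ω f · V dx`. -/
def load {d : ℕ} {Ω : Set (Vec d)} (f : L2Vec Ω) (V : Pair Ω) : ℝ :=
  ∫ x in Ω, inner ℝ (f x) (V.1 x)

/-- `(U', P') ∈ 𝕍(T) × ℚ_0(T)` solves the discrete problem whose viscosity is frozen at `W`:
`a_n(W; U', V) + b(P', V) + b(Q, U') = ∫_Ω f · V dx` for all `(V, Q) ∈ 𝕍(T) × ℚ(T)`. -/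
def SolvesFrozen {d : ℕ} (Ω : Set (Vec d)) (T : Geometry.SimplicialComplex ℝ (Vec d))
    (PV : Finset (Vec d) → Submodule ℝ (Fin d → MvPolynomial (Fin d) ℝ))
    (PQ : Finset (Vec d) → Submodule ℝ (MvPolynomial (Fin d) ℝ))
    (σ ν : ℝ) (n : ℕ) (f : L2Vec Ω) (W U' : Pair Ω) (P' : LInf Ω) : Prop :=
  U' ∈ velocitySpace Ω T PV ∧ IsZeroMeanPressure Ω T PQ P' ∧
    ∀ V ∈ velocitySpace Ω T PV, ∀ Q ∈ pressureSpace Ω T PQ,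
      formA σ ν n W U' V + formB P' V + formB Q U' = load f V

/-- `(U, P)` solves the regularised convection-free discrete Bingham problem
`a_n(U; U, V) + b(P, V) + b(Q, U) = ∫_Ω f · V dx`. -/
def IsDiscreteSolution {d : ℕ} (Ω : Set (Vec d)) (T : Geometry.SimplicialComplex ℝ (Vec d))
    (PV : Finset (Vec d) → Submodule ℝ (Fin d → MvPolynomial (Fin d) ℝ))
    (PQ : Finset (Vec d) → Submodule ℝ (MvPolynomial (Fin d) ℝ))
    (σ ν : ℝ) (n : ℕ) (f : L2Vec Ω) (U : Pair Ω) (P : LInf Ω) : Prop :=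
  SolvesFrozen Ω T PV PQ σ ν n f U U P

/-- `(Uℓ ℓ)` is a sequence of velocities generated by the Kačanov iteration: the initial guess
`Uℓ 0` is in `𝕍(T)`, and each `Uℓ (ℓ + 1)` is, together with the pressure `Pℓ (ℓ + 1)`, a
solution of the linear discrete problem with the viscosity frozen at `Uℓ ℓ`. (The value
`Pℓ 0` is not used.) -/
def IsKacanovSequence {d : ℕ} (Ω : Set (Vec d)) (T : Geometry.SimplicialComplex ℝ (Vec d))
    (PV : Finset (Vec d) → Submodule ℝ (Fin d → MvPolynomial (Fin d) ℝ))
    (PQ : Finset (Vec d) → Submodule ℝ (MvPolynomial (Fin d) ℝ))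
    (σ ν : ℝ) (n : ℕ) (f : L2Vec Ω) (Uℓ : ℕ → Pair Ω) (Pℓ : ℕ → LInf Ω) : Prop :=
  Uℓ 0 ∈ velocitySpace Ω T PV ∧
    ∀ ℓ : ℕ, SolvesFrozen Ω T PV PQ σ ν n f (Uℓ ℓ) (Uℓ (ℓ + 1)) (Pℓ (ℓ + 1))

/-- The contraction factor `q_con = 1 - ν³ / ((√3 σ n + 2ν) (σ n + 2ν)²)`. -/
def qCon (σ ν : ℝ) (n : ℕ) : ℝ :=
  1 - ν ^ 3 / ((Real.sqrt 3 * σ * n + 2 * ν) * (σ * n + 2 * ν) ^ 2)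

end KacanovFE

end

open MeasureTheory Filter Topology

/-! The discrete problem is the Euler–Lagrange equation of the energy `E(S) = ∫ σ √(|S|² + c) + ν
|S|²`, `c = n⁻²`, restricted to discretely divergence-free velocities, with `S` the symmetric
gradient. The density is concave as a function of `|S|²`, so freezing the viscosity at `W` gives a
quadratic majorant of `E` that touches it at `W`; a Kačanov step minimises this majorant.

The error is measured by the Bregman distance `B(S, R) = E(R) - E(S) - E'(S)(R - S)` to the solution
`S`. Strong convexity gives `B(S, R) ≥ ν ‖R - S‖²`. With `s = σ n`, the frozen form lies between `0`
and `(s + 2ν) ‖·‖²`; combined with strong convexity and the majorant this yields `B(S, T) ≤ s / (s +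
2ν) · B(S, W)` for a step from `W` to `T` (`bregman_step_contract`). This needs `W - S` as a test
function, which fails for an initial guess that is not discretely divergence free. The first step is
therefore handled by `bregman_step_le`, which uses only that the majorant exceeds `E` by at most
`s/2 ‖W - S‖²`.

Korn's inequality with constant `2` (`norm_sq_grad_le_of_mem_sobolevZero`) returns from symmetric to
full gradients. The resulting factor `s / (s + 2ν)` is at most `q_con` (`qCon_bounds`), and the
prefactor is likewise at most the claimed one. -/

namespace KacanovFE

/-! ### Pointwise convexity and majorant estimates for the density -/

section Pointwise

variable {E : Type*} [NormedAddCommGroup E]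

/-- The regularised viscosity `σ / √(|G|² + c) + 2ν`. -/
noncomputable def visc (σ ν c : ℝ) (G : E) : ℝ := σ / Real.sqrt (‖G‖ ^ 2 + c) + 2 * ν

/-- The density `σ √(|G|² + c) + ν |G|²` of the dissipation potential. -/
noncomputable def potential (σ ν c : ℝ) (G : E) : ℝ :=
  σ * Real.sqrt (‖G‖ ^ 2 + c) + ν * ‖G‖ ^ 2

variable {σ ν c s : ℝ}

lemma sqrt_norm_sq_add_pos (hc : 0 < c) (G : E) : 0 < Real.sqrt (‖G‖ ^ 2 + c) :=
  Real.sqrt_pos.2 (by positivity)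

lemma visc_nonneg (hσ : 0 ≤ σ) (hν : 0 < ν) (G : E) : 0 ≤ visc σ ν c G := by
  unfold visc; positivity

/-- The singular quotient is largest at `G = 0`. The parameter `s` stands for any upper bound of `σ
/ √c`; it becomes `σ n` when `c = n⁻²`. -/
lemma div_sqrt_le (hc : 0 < c) (hs0 : 0 ≤ s) (hs : σ ≤ s * Real.sqrt c) (G : E) :
    σ / Real.sqrt (‖G‖ ^ 2 + c) ≤ s := by
  rw [div_le_iff₀ (sqrt_norm_sq_add_pos hc G)]
  exact hs.trans (mul_le_mul_of_nonneg_left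
    (Real.sqrt_le_sqrt (by nlinarith [sq_nonneg ‖G‖])) hs0)

lemma visc_le (hc : 0 < c) (hs0 : 0 ≤ s) (hs : σ ≤ s * Real.sqrt c) (G : E) :
    visc σ ν c G ≤ s + 2 * ν := by
  have := div_sqrt_le hc hs0 hs G
  unfold visc; linarith

lemma continuous_visc (hc : 0 < c) : Continuous (visc σ ν c : E → ℝ) := by
  unfold visc
  refine (continuous_const.div (by fun_prop) fun G => (sqrt_norm_sq_add_pos hc G).ne').add
    continuous_const

variable [InnerProductSpace ℝ E]

/-- Strong convexity of the potential. -/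
lemma potential_strong_convexity (hσ : 0 ≤ σ) (hc : 0 < c) (S R : E) :
    ν * ‖R - S‖ ^ 2 ≤
      potential σ ν c R - potential σ ν c S - visc σ ν c S * inner ℝ S (R - S) := by
  have ha := sqrt_norm_sq_add_pos hc S
  have hb := sqrt_norm_sq_add_pos hc R
  set a := Real.sqrt (‖S‖ ^ 2 + c) with hadef
  set b := Real.sqrt (‖R‖ ^ 2 + c) with hbdef
  have ha2 : a ^ 2 = ‖S‖ ^ 2 + c := Real.sq_sqrt (by positivity)
  have hb2 : b ^ 2 = ‖R‖ ^ 2 + c := Real.sq_sqrt (by positivity)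
  have hCS := real_inner_le_norm S R
  have hin : inner ℝ S (R - S) = inner ℝ S R - ‖S‖ ^ 2 := by
    rw [inner_sub_right, real_inner_self_eq_norm_sq]
  -- Cauchy–Schwarz for `(‖S‖, √c)` and `(‖R‖, √c)` in the plane; it makes `√(|·|² + c)` convex. The
  -- modulus `ν` then comes entirely from the quadratic term.
  have hab : ‖S‖ * ‖R‖ + c ≤ a * b := by
    refine abs_le_of_sq_le_sq' ?_ (by positivity) |>.2
    rw [mul_pow, ha2, hb2]
    nlinarith [sq_nonneg (‖S‖ - ‖R‖)]
  have hkey : inner ℝ S (R - S) / a ≤ b - a := by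
    rw [div_le_iff₀ ha, hin]
    nlinarith
  have hnorm : ‖R - S‖ ^ 2 = ‖R‖ ^ 2 - 2 * inner ℝ S R + ‖S‖ ^ 2 := by
    rw [norm_sub_sq_real, real_inner_comm]
  have h := mul_le_mul_of_nonneg_left hkey hσ
  have e : σ / a * inner ℝ S (R - S) = σ * (inner ℝ S (R - S) / a) := by ring
  simp only [potential, visc, ← hadef, ← hbdef]
  rw [add_mul, e, hnorm]
  rw [hin] at h ⊢
  linarith

/-- The `ν` terms cancel. With `a`, `b` the two square roots, what remains is `σ (a + (b² - a²) /
(2a) - b)`, a perfect square over `2a`. -/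
lemma potential_majorant_gap_eq (hc : 0 < c) (W S : E) :
    potential σ ν c W + (visc σ ν c W * inner ℝ S S - visc σ ν c W * inner ℝ W W) / 2
      - potential σ ν c S = σ / Real.sqrt (‖W‖ ^ 2 + c) *
        (Real.sqrt (‖W‖ ^ 2 + c) - Real.sqrt (‖S‖ ^ 2 + c)) ^ 2 / 2 := by
  have ha := sqrt_norm_sq_add_pos hc W
  have ha2 : Real.sqrt (‖W‖ ^ 2 + c) ^ 2 = ‖W‖ ^ 2 + c := Real.sq_sqrt (by positivity)
  have hb2 : Real.sqrt (‖S‖ ^ 2 + c) ^ 2 = ‖S‖ ^ 2 + c := Real.sq_sqrt (by positivity)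
  simp only [potential, visc, real_inner_self_eq_norm_sq]
  have e1 : ‖W‖ ^ 2 = Real.sqrt (‖W‖ ^ 2 + c) ^ 2 - c := by rw [ha2]; ring
  have e2 : ‖S‖ ^ 2 = Real.sqrt (‖S‖ ^ 2 + c) ^ 2 - c := by rw [hb2]; ring
  generalize Real.sqrt (‖W‖ ^ 2 + c) = a at *
  generalize Real.sqrt (‖S‖ ^ 2 + c) = b at *
  rw [e1, e2]
  field_simp
  ring

/-- The quadratic majorant at `W` lies above the potential. -/
lemma potential_majorant_gap_nonneg (hσ : 0 ≤ σ) (hc : 0 < c) (W S : E) :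
    0 ≤ potential σ ν c W + (visc σ ν c W * inner ℝ S S - visc σ ν c W * inner ℝ W W) / 2
      - potential σ ν c S := by
  rw [potential_majorant_gap_eq hc]
  positivity

/-- In the exact gap formula the quotient is at most `s`, and `√(|·|² + c)` is 1-Lipschitz. -/
lemma potential_majorant_gap_le (hc : 0 < c) (hs0 : 0 ≤ s)
    (hs : σ ≤ s * Real.sqrt c) (W S : E) :
    potential σ ν c W + (visc σ ν c W * inner ℝ S S - visc σ ν c W * inner ℝ W W) / 2
      - potential σ ν c S ≤ s / 2 * ‖W - S‖ ^ 2 := by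
  rw [potential_majorant_gap_eq hc]
  have h1 := div_sqrt_le hc hs0 hs W
  have ha := sqrt_norm_sq_add_pos hc W
  have hb := sqrt_norm_sq_add_pos hc S
  have ha2 : Real.sqrt (‖W‖ ^ 2 + c) ^ 2 = ‖W‖ ^ 2 + c := Real.sq_sqrt (by positivity)
  have hb2 : Real.sqrt (‖S‖ ^ 2 + c) ^ 2 = ‖S‖ ^ 2 + c := Real.sq_sqrt (by positivity)
  generalize Real.sqrt (‖W‖ ^ 2 + c) = a at *
  generalize Real.sqrt (‖S‖ ^ 2 + c) = b at *
  have hab : ‖W‖ * ‖S‖ + c ≤ a * b := by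
    refine abs_le_of_sq_le_sq' ?_ (by positivity) |>.2
    rw [mul_pow, ha2, hb2]
    nlinarith [sq_nonneg (‖W‖ - ‖S‖)]
  have h2 : (a - b) ^ 2 ≤ ‖W - S‖ ^ 2 := by
    rw [norm_sub_sq_real]
    nlinarith [real_inner_le_norm W S]
  have := mul_le_mul h1 h2 (sq_nonneg _) hs0
  linarith

end Pointwise

/-! ### Integrability of the density -/

lemma integrable_norm_sq {α E : Type*} [MeasurableSpace α] {μ : Measure α}
    [NormedAddCommGroup E] {S : α → E} (hS : MemLp S 2 μ) :
    Integrable (fun x => ‖S x‖ ^ 2) μ :=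
  hS.integrable_norm_pow two_ne_zero

lemma integrable_potential {α E : Type*} [MeasurableSpace α] {μ : Measure α}
    [IsFiniteMeasure μ] [NormedAddCommGroup E] {σ ν c : ℝ} {S : α → E} (hS : MemLp S 2 μ) :
    Integrable (fun x => potential σ ν c (S x)) μ := by
  refine Integrable.add (Integrable.const_mul ?_ σ) ((integrable_norm_sq hS).const_mul ν)
  have hd : Integrable (fun x => ‖S x‖ ^ 2 + |c| + 1) μ :=
    ((integrable_norm_sq hS).add (integrable_const _)).add (integrable_const _)
  refine hd.mono'
    (Real.continuous_sqrt.comp_aestronglyMeasurable ((integrable_norm_sq hS).1.add_const c)) ?_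
  refine Eventually.of_forall fun x => ?_
  rw [Real.norm_of_nonneg (Real.sqrt_nonneg _)]
  refine Real.sqrt_le_iff.2 ⟨by positivity, ?_⟩
  nlinarith [sq_nonneg ‖S x‖, abs_nonneg c, le_abs_self c, sq_nonneg (‖S x‖ ^ 2 + |c|)]

/-! ### Energy, Bregman distance and the Kačanov step in an abstract `L²` setting -/

section Integrated

variable {α E : Type*} [MeasurableSpace α] {μ : Measure α}
  [NormedAddCommGroup E] [InnerProductSpace ℝ E] {σ ν c s : ℝ} {W S T R : α → E}

/-- `∫ (σ / √(|W|² + c) + 2ν) ⟪S, R⟫`. -/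
noncomputable def viscForm (μ : Measure α) (σ ν c : ℝ) (W S R : α → E) : ℝ :=
  ∫ x, visc σ ν c (W x) * inner ℝ (S x) (R x) ∂μ

/-- `∫ potential`. -/
noncomputable def energy (μ : Measure α) (σ ν c : ℝ) (S : α → E) : ℝ :=
  ∫ x, potential σ ν c (S x) ∂μ

/-- The Bregman distance `E(R) - E(S) - E'(S)(R - S)` of the energy. -/
noncomputable def bregman (μ : Measure α) (σ ν c : ℝ) (S R : α → E) : ℝ :=
  energy μ σ ν c R - energy μ σ ν c S - viscForm μ σ ν c S S (R - S)

lemma integrable_visc_mul_inner (hσ : 0 ≤ σ) (hν : 0 < ν) (hc : 0 < c)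
    (hW : AEStronglyMeasurable W μ) (hS : MemLp S 2 μ) (hR : MemLp R 2 μ) :
    Integrable (fun x => visc σ ν c (W x) * inner ℝ (S x) (R x)) μ := by
  have hin : Integrable (fun x => inner ℝ (S x) (R x)) μ := by
    refine (hS.norm.integrable_mul hR.norm).mono' (hS.1.inner hR.1) ?_
    exact Eventually.of_forall fun x => norm_inner_le_norm _ _
  refine hin.bdd_mul (c := σ / Real.sqrt c + 2 * ν)
    ((continuous_visc hc).comp_aestronglyMeasurable hW) (Eventually.of_forall fun x => ?_)
  rw [Real.norm_of_nonneg (visc_nonneg hσ hν _)]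
  have h0 : Real.sqrt c ≠ 0 := (Real.sqrt_pos.2 hc).ne'
  exact visc_le hc (by positivity) (by field_simp; rfl) _

lemma viscForm_comm (W S R : α → E) : viscForm μ σ ν c W S R = viscForm μ σ ν c W R S := by
  simp only [viscForm, real_inner_comm]

lemma viscForm_sub_right (hσ : 0 ≤ σ) (hν : 0 < ν) (hc : 0 < c)
    (hW : AEStronglyMeasurable W μ) (hS : MemLp S 2 μ) (hR : MemLp R 2 μ) (hT : MemLp T 2 μ) :
    viscForm μ σ ν c W S (R - T) = viscForm μ σ ν c W S R - viscForm μ σ ν c W S T := by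
  simp only [viscForm]
  rw [← integral_sub (integrable_visc_mul_inner hσ hν hc hW hS hR)
    (integrable_visc_mul_inner hσ hν hc hW hS hT)]
  simp only [Pi.sub_apply, inner_sub_right, mul_sub]

lemma viscForm_sub_left (hσ : 0 ≤ σ) (hν : 0 < ν) (hc : 0 < c)
    (hW : AEStronglyMeasurable W μ) (hS : MemLp S 2 μ) (hR : MemLp R 2 μ) (hT : MemLp T 2 μ) :
    viscForm μ σ ν c W (R - T) S = viscForm μ σ ν c W R S - viscForm μ σ ν c W T S := by
  rw [viscForm_comm, viscForm_sub_right hσ hν hc hW hS hR hT, viscForm_comm W S R,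
    viscForm_comm W S T]

lemma viscForm_smul_right (a : ℝ) (W S R : α → E) :
    viscForm μ σ ν c W S (a • R) = a * viscForm μ σ ν c W S R := by
  simp only [viscForm, ← integral_const_mul, Pi.smul_apply, inner_smul_right]
  congr 1; ext x; ring

lemma viscForm_smul_left (a : ℝ) (W S R : α → E) :
    viscForm μ σ ν c W (a • S) R = a * viscForm μ σ ν c W S R := by
  rw [viscForm_comm, viscForm_smul_right, viscForm_comm]

lemma viscForm_self_nonneg (hσ : 0 ≤ σ) (hν : 0 < ν) (W S : α → E) :
    0 ≤ viscForm μ σ ν c W S S :=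
  integral_nonneg fun _ => mul_nonneg (visc_nonneg hσ hν _) real_inner_self_nonneg

lemma viscForm_self_le (hσ : 0 ≤ σ) (hν : 0 < ν) (hc : 0 < c) (hs0 : 0 ≤ s)
    (hs : σ ≤ s * Real.sqrt c) (hW : AEStronglyMeasurable W μ) (hS : MemLp S 2 μ) :
    viscForm μ σ ν c W S S ≤ (s + 2 * ν) * ∫ x, ‖S x‖ ^ 2 ∂μ := by
  rw [← integral_const_mul]
  refine integral_mono (integrable_visc_mul_inner hσ hν hc hW hS hS)
    ((integrable_norm_sq hS).const_mul _) fun x => ?_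
  simp only [real_inner_self_eq_norm_sq]
  exact mul_le_mul_of_nonneg_right (visc_le hc hs0 hs _) (by positivity)

lemma mul_integral_norm_sub_sq_le_bregman [IsFiniteMeasure μ] (hσ : 0 ≤ σ) (hν : 0 < ν)
    (hc : 0 < c) (hS : MemLp S 2 μ) (hR : MemLp R 2 μ) :
    ν * ∫ x, ‖(R - S) x‖ ^ 2 ∂μ ≤ bregman μ σ ν c S R := by
  have hp := (integrable_potential (σ := σ) (ν := ν) (c := c) hR).sub
    (integrable_potential (σ := σ) (ν := ν) (c := c) hS)
  have hv := integrable_visc_mul_inner hσ hν hc hS.1 hS (hR.sub hS)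
  have e : bregman μ σ ν c S R = ∫ x, (potential σ ν c (R x) - potential σ ν c (S x) -
      visc σ ν c (S x) * inner ℝ (S x) ((R - S) x)) ∂μ :=
    ((integral_sub hp hv).trans (congrArg (· - _)
      (integral_sub (integrable_potential hR) (integrable_potential hS)))).symm
  rw [e, ← integral_const_mul]
  exact integral_mono ((integrable_norm_sq (hR.sub hS)).const_mul ν) (hp.sub hv)
    fun x => potential_strong_convexity hσ hc (S x) (R x)

lemma energy_majorant_gap_eq [IsFiniteMeasure μ] (hσ : 0 ≤ σ) (hν : 0 < ν) (hc : 0 < c)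
    (hW : MemLp W 2 μ) (hS : MemLp S 2 μ) :
    Integrable (fun x => potential σ ν c (W x) + (visc σ ν c (W x) * inner ℝ (S x) (S x) -
      visc σ ν c (W x) * inner ℝ (W x) (W x)) / 2 - potential σ ν c (S x)) μ ∧
    energy μ σ ν c W + (viscForm μ σ ν c W S S - viscForm μ σ ν c W W W) / 2
      - energy μ σ ν c S =
    ∫ x, (potential σ ν c (W x) + (visc σ ν c (W x) * inner ℝ (S x) (S x) -
      visc σ ν c (W x) * inner ℝ (W x) (W x)) / 2 - potential σ ν c (S x)) ∂μ := by
  have hWS := integrable_visc_mul_inner hσ hν hc hW.1 hS hS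
  have hWW := integrable_visc_mul_inner hσ hν hc hW.1 hW hW
  have hpW := integrable_potential (σ := σ) (ν := ν) (c := c) hW
  have hpS := integrable_potential (σ := σ) (ν := ν) (c := c) hS
  have hd := (hWS.sub hWW).div_const 2
  refine ⟨(hpW.add hd).sub hpS, ?_⟩
  simp only [energy, viscForm]
  rw [← integral_sub hWS hWW, ← integral_div]
  exact ((integral_sub (hpW.add hd) hpS).trans (congrArg (· - _) (integral_add hpW hd))).symm

lemma energy_le_majorant [IsFiniteMeasure μ] (hσ : 0 ≤ σ) (hν : 0 < ν) (hc : 0 < c)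
    (hW : MemLp W 2 μ) (hS : MemLp S 2 μ) :
    energy μ σ ν c S ≤
      energy μ σ ν c W + (viscForm μ σ ν c W S S - viscForm μ σ ν c W W W) / 2 := by
  rw [← sub_nonneg, (energy_majorant_gap_eq hσ hν hc hW hS).2]
  exact integral_nonneg fun x => potential_majorant_gap_nonneg hσ hc _ _

lemma majorant_le_energy_add [IsFiniteMeasure μ] (hσ : 0 ≤ σ) (hν : 0 < ν) (hc : 0 < c)
    (hs0 : 0 ≤ s) (hs : σ ≤ s * Real.sqrt c) (hW : MemLp W 2 μ) (hS : MemLp S 2 μ) :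
    energy μ σ ν c W + (viscForm μ σ ν c W S S - viscForm μ σ ν c W W W) / 2
      - energy μ σ ν c S ≤ s / 2 * ∫ x, ‖(W - S) x‖ ^ 2 ∂μ := by
  obtain ⟨hi, he⟩ := energy_majorant_gap_eq hσ hν hc hW hS
  rw [he, ← integral_const_mul]
  exact integral_mono hi ((integrable_norm_sq (hW.sub hS)).const_mul _) fun x =>
    potential_majorant_gap_le hc hs0 hs _ _

/-- One Kačanov step, from an arbitrary initial value `W`. -/
lemma bregman_step_le [IsFiniteMeasure μ] (hσ : 0 ≤ σ) (hν : 0 < ν) (hc : 0 < c)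
    (hs0 : 0 ≤ s) (hs : σ ≤ s * Real.sqrt c) (hW : MemLp W 2 μ) (hS : MemLp S 2 μ)
    (hT : MemLp T 2 μ)
    (hTS : viscForm μ σ ν c W T (T - S) = viscForm μ σ ν c S S (T - S)) :
    bregman μ σ ν c S T ≤ s / 2 * ∫ x, ‖(W - S) x‖ ^ 2 ∂μ := by
  have h1 := energy_le_majorant hσ hν hc hW hT
  have h2 := majorant_le_energy_add hσ hν hc hs0 hs hW hS
  -- The square of `T - S` in the frozen form is exactly the surplus left when the two majorant
  -- bounds are combined.
  have h3 := viscForm_self_nonneg (μ := μ) (c := c) hσ hν W (T - S)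
  rw [viscForm_sub_left hσ hν hc hW.1 (hT.sub hS) hT hS,
    viscForm_sub_right hσ hν hc hW.1 hS hT hS,
    viscForm_sub_right hσ hν hc hW.1 hT hT hS, viscForm_comm W S T] at h3
  rw [bregman, ← hTS, viscForm_sub_right hσ hν hc hW.1 hT hT hS]
  linarith

/-- One Kačanov step, from an initial value `W` for which `W - S` is an admissible test
function, contracts the Bregman distance to the solution `S`. -/
lemma bregman_step_contract [IsFiniteMeasure μ] (hσ : 0 ≤ σ) (hν : 0 < ν) (hc : 0 < c)
    (hs0 : 0 ≤ s) (hs : σ ≤ s * Real.sqrt c) (hW : MemLp W 2 μ) (hS : MemLp S 2 μ)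
    (hT : MemLp T 2 μ)
    (hTS : viscForm μ σ ν c W T (T - S) = viscForm μ σ ν c S S (T - S))
    (hWS : viscForm μ σ ν c W T (W - S) = viscForm μ σ ν c S S (W - S)) :
    bregman μ σ ν c S T ≤ s / (s + 2 * ν) * bregman μ σ ν c S W := by
  have hp : 0 < s + 2 * ν := by positivity
  have h1 := energy_le_majorant hσ hν hc hW hT
  have h2 := mul_integral_norm_sub_sq_le_bregman hσ hν hc hW hS
  have h4 := viscForm_self_le hσ hν hc hs0 hs hW.1 (hW.sub hS)
  have hsq : ∫ x, ‖(S - W) x‖ ^ 2 ∂μ = ∫ x, ‖(W - S) x‖ ^ 2 ∂μ := by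
    simp only [Pi.sub_apply, norm_sub_rev]
  -- The weights `s + 2ν` and `2ν` are chosen so that, after `h4`, the square bounds `(s + 2ν) q`
  -- below by `4ν (r - ν I)`, with `q`, `r`, `I` as set below.
  have h5 := viscForm_self_nonneg (μ := μ) (c := c) hσ hν W
    ((s + 2 * ν) • (W - T) - (2 * ν) • (W - S))
  rw [viscForm_sub_left hσ hν hc hW.1
      (((hW.sub hT).const_smul _).sub ((hW.sub hS).const_smul _))
      ((hW.sub hT).const_smul _) ((hW.sub hS).const_smul _),
    viscForm_sub_right hσ hν hc hW.1 ((hW.sub hT).const_smul _)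
      ((hW.sub hT).const_smul _) ((hW.sub hS).const_smul _),
    viscForm_sub_right hσ hν hc hW.1 ((hW.sub hS).const_smul _)
      ((hW.sub hT).const_smul _) ((hW.sub hS).const_smul _)] at h5
  simp only [viscForm_smul_left, viscForm_smul_right] at h5
  rw [viscForm_comm W (W - S) (W - T)] at h5
  rw [bregman, hsq, viscForm_sub_right hσ hν hc hW.1 hW hS hW] at h2
  set I := ∫ x, ‖(W - S) x‖ ^ 2 ∂μ
  have e1 : viscForm μ σ ν c W (W - T) (W - S) =
      viscForm μ σ ν c W W W - viscForm μ σ ν c W W S - viscForm μ σ ν c W T (W - S) := by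
    rw [viscForm_sub_left hσ hν hc hW.1 (hW.sub hS) hW hT,
      viscForm_sub_right hσ hν hc hW.1 hW hW hS]
  have e2 : viscForm μ σ ν c W (W - T) (W - T) =
      viscForm μ σ ν c W W W - 2 * viscForm μ σ ν c W T W + viscForm μ σ ν c W T T := by
    rw [viscForm_sub_left hσ hν hc hW.1 (hW.sub hT) hW hT,
      viscForm_sub_right hσ hν hc hW.1 hW hW hT,
      viscForm_sub_right hσ hν hc hW.1 hT hW hT, viscForm_comm W W T]
    ring
  rw [bregman, bregman, ← hWS, ← hTS, viscForm_sub_right hσ hν hc hW.1 hT hT hS]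
  set q := viscForm μ σ ν c W (W - T) (W - T)
  set r := viscForm μ σ ν c W (W - T) (W - S)
  set δ := energy μ σ ν c W - energy μ σ ν c S - viscForm μ σ ν c W T (W - S) with hδ
  -- `δ` is the Bregman distance of `W` from `S`. The bound is strong convexity based at `W` instead
  -- of `S`, which makes the form frozen at `W` appear.
  have k1 : δ ≤ r - ν * I := by rw [e1, hδ]; linarith
  have k2 : 4 * ν * δ ≤ (s + 2 * ν) * q := by
    have m1 := mul_le_mul_of_nonneg_left k1 (show (0:ℝ) ≤ 4 * ν * (s + 2 * ν) by positivity)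
    have m2 := mul_le_mul_of_nonneg_left h4 (show (0:ℝ) ≤ 4 * ν ^ 2 by positivity)
    have : (s + 2 * ν) * (4 * ν * δ) ≤ (s + 2 * ν) * ((s + 2 * ν) * q) := by linarith
    exact le_of_mul_le_mul_left this hp
  -- The majorant at `W` shows that the step lowers the Bregman distance by at least `q / 2`. Since
  -- `k2` gives `q / 2 ≥ 2ν δ / (s + 2ν)`, the factor `s / (s + 2ν)` remains.
  have k3 : energy μ σ ν c T - energy μ σ ν c S -
      (viscForm μ σ ν c W T T - viscForm μ σ ν c W T S) ≤ δ - q / 2 := by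
    rw [e2, hδ, viscForm_sub_right hσ hν hc hW.1 hT hW hS]
    linarith
  refine k3.trans ?_
  rw [div_mul_eq_mul_div, le_div_iff₀ hp]
  linarith

/-- Linear convergence of the Kačanov iteration. -/
lemma integral_norm_sub_sq_kacanov_le [IsFiniteMeasure μ] (hσ : 0 ≤ σ) (hν : 0 < ν)
    (hc : 0 < c) (hs0 : 0 ≤ s) (hs : σ ≤ s * Real.sqrt c) (hS : MemLp S 2 μ)
    {Sℓ : ℕ → α → E} (hSℓ : ∀ ℓ, MemLp (Sℓ ℓ) 2 μ)
    (hstep : ∀ ℓ k, viscForm μ σ ν c (Sℓ ℓ) (Sℓ (ℓ + 1)) (Sℓ (k + 1) - S) =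
      viscForm μ σ ν c S S (Sℓ (k + 1) - S)) (ℓ : ℕ) :
    ∫ x, ‖(Sℓ ℓ - S) x‖ ^ 2 ∂μ ≤
      (s + 2 * ν) / (2 * ν) * (s / (s + 2 * ν)) ^ ℓ * ∫ x, ‖(Sℓ 0 - S) x‖ ^ 2 ∂μ := by
  have hp : 0 < s + 2 * ν := by positivity
  have hI : 0 ≤ ∫ x, ‖(Sℓ 0 - S) x‖ ^ 2 ∂μ := integral_nonneg fun x => by positivity
  set I := ∫ x, ‖(Sℓ 0 - S) x‖ ^ 2 ∂μ
  rcases ℓ with _ | ℓ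
  · rw [pow_zero, mul_one]
    exact le_mul_of_one_le_left hI ((one_le_div (by positivity)).2 (by linarith))
  have hB : ∀ m, bregman μ σ ν c S (Sℓ (m + 1)) ≤ (s / (s + 2 * ν)) ^ m * (s / 2 * I) := by
    intro m
    induction m with
    | zero =>
      rw [pow_zero, one_mul]
      exact bregman_step_le hσ hν hc hs0 hs (hSℓ 0) hS (hSℓ 1) (hstep 0 0)
    | succ m ih =>
      refine (bregman_step_contract hσ hν hc hs0 hs (hSℓ _) hS (hSℓ _) (hstep _ _)
        (hstep _ _)).trans ?_
      rw [pow_succ', mul_assoc]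
      exact mul_le_mul_of_nonneg_left ih (by positivity)
  have h := (mul_integral_norm_sub_sq_le_bregman hσ hν hc hS (hSℓ (ℓ + 1))).trans (hB ℓ)
  rw [← le_div_iff₀' hν] at h
  refine h.trans_eq ?_
  -- The factor `s / (2ν)` equals `(s + 2ν) / (2ν) · s / (s + 2ν)`, which supplies the power missing
  -- from the first step.
  rw [pow_succ]
  field_simp

end Integrated

/-! ### Symmetric gradients and Korn's inequality -/

section Sobolev

variable {d : ℕ} {Ω : Set (Vec d)}

/-- The symmetric part of a matrix, as a continuous linear map. -/
noncomputable def symL (d : ℕ) : Mat d →L[ℝ] Mat d :=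
  LinearMap.toContinuousLinearMap
    { toFun := sym
      map_add' := fun G H => by ext p; simp [sym]; ring
      map_smul' := fun a G => by ext p; simp [sym]; ring }

lemma symL_apply (G : Mat d) : symL d G = sym G := rfl

lemma sym_sub (G H : Mat d) : sym (G - H) = sym G - sym H := map_sub (symL d) G H

/-- The trace of a matrix, as a continuous linear map. -/
noncomputable def trL (d : ℕ) : Mat d →L[ℝ] ℝ :=
  LinearMap.toContinuousLinearMap
    { toFun := tr
      map_add' := fun G H => by simp [tr, Finset.sum_add_distrib]
      map_smul' := fun a G => by simp [tr, Finset.mul_sum] }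

lemma trL_apply (G : Mat d) : trL d G = tr G := rfl

/-- Expand the square of `(G + Gᵀ) / 2`. This reduces Korn's inequality to the sign of `∫ ∇v :
(∇v)ᵀ`. -/
lemma sum_mul_swap_eq (G : Mat d) :
    ∑ p : Fin d × Fin d, G p * G p.swap = 2 * ‖sym G‖ ^ 2 - ‖G‖ ^ 2 := by
  have hswap : ∑ p : Fin d × Fin d, G p.swap ^ 2 = ∑ p : Fin d × Fin d, G p ^ 2 :=
    Equiv.sum_comp (Equiv.prodComm (Fin d) (Fin d)) fun p => G p ^ 2
  rw [EuclideanSpace.real_norm_sq_eq, EuclideanSpace.real_norm_sq_eq]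
  have h : ∑ p : Fin d × Fin d, (sym G p) ^ 2 = (∑ p : Fin d × Fin d, G p ^ 2) / 4 +
      (∑ p : Fin d × Fin d, G p.swap ^ 2) / 4 + (∑ p : Fin d × Fin d, G p * G p.swap) / 2 := by
    rw [Finset.sum_div, Finset.sum_div, Finset.sum_div, ← Finset.sum_add_distrib,
      ← Finset.sum_add_distrib]
    refine Finset.sum_congr rfl fun p _ => ?_
    simp only [sym]
    ring
  rw [h, hswap]
  ring

lemma norm_sym_le (G : Mat d) : ‖sym G‖ ≤ ‖G‖ := by
  have hswap : ∑ p : Fin d × Fin d, G p.swap ^ 2 = ∑ p : Fin d × Fin d, G p ^ 2 :=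
    Equiv.sum_comp (Equiv.prodComm (Fin d) (Fin d)) fun p => G p ^ 2
  refine abs_le_of_sq_le_sq' ?_ (norm_nonneg _) |>.2
  have h1 : ∑ p : Fin d × Fin d, G p * G p.swap ≤ ‖G‖ ^ 2 := by
    have h2 : ∑ p : Fin d × Fin d, G p * G p.swap ≤
        ∑ p : Fin d × Fin d, (G p ^ 2 / 2 + G p.swap ^ 2 / 2) :=
      Finset.sum_le_sum fun p _ => by nlinarith [sq_nonneg (G p - G p.swap)]
    rw [Finset.sum_add_distrib, ← Finset.sum_div, ← Finset.sum_div, hswap,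
      ← EuclideanSpace.real_norm_sq_eq] at h2
    linarith
  rw [sum_mul_swap_eq] at h1
  linarith

/-- Integrate by parts to move the derivative off `f`, then use the symmetry of the second
derivative of `g`. Compact support of `f` alone removes the boundary terms. -/
lemma integral_fderiv_mul_fderiv_comm {E : Type*} [NormedAddCommGroup E] [NormedSpace ℝ E]
    [FiniteDimensional ℝ E] [MeasurableSpace E] [BorelSpace E] {μ : Measure E}
    [μ.IsAddHaarMeasure] {f g : E → ℝ} (hf : ContDiff ℝ (⊤ : ℕ∞) f)
    (hfc : HasCompactSupport f) (hg : ContDiff ℝ (⊤ : ℕ∞) g) (u v : E) :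
    ∫ x, fderiv ℝ f x u * fderiv ℝ g x v ∂μ = ∫ x, fderiv ℝ f x v * fderiv ℝ g x u ∂μ := by
  have hg' : ∀ w, ContDiff ℝ (⊤ : ℕ∞) fun x => fderiv ℝ g x w := fun w =>
    (hg.fderiv_right (by simp)).clm_apply contDiff_const
  have hf' : ∀ w, Continuous fun x => fderiv ℝ f x w := fun w =>
    (hf.continuous_fderiv (by simp)).clm_apply continuous_const
  have hfc' : ∀ w, HasCompactSupport fun x => fderiv ℝ f x w := fun w => hfc.fderiv_apply (𝕜 := ℝ) w
  have key : ∀ u v, ∫ x, fderiv ℝ f x u * fderiv ℝ g x v ∂μ =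
      - ∫ x, f x * fderiv ℝ (fun y => fderiv ℝ g y v) x u ∂μ := by
    intro u v
    have hg'' : Continuous fun x => fderiv ℝ (fun y => fderiv ℝ g y v) x u :=
      ((hg' v).continuous_fderiv (by simp)).clm_apply continuous_const
    rw [integral_mul_fderiv_eq_neg_fderiv_mul_of_integrable (f := f), neg_neg]
    · exact ((hf' u).mul (hg' v).continuous).integrable_of_hasCompactSupport (hfc' u).mul_right
    · exact (hf.continuous.mul hg'').integrable_of_hasCompactSupport hfc.mul_right
    · exact (hf.continuous.mul (hg' v).continuous).integrable_of_hasCompactSupport hfc.mul_right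
    · exact fun x _ => hf.differentiable (by simp) x
    · exact fun x _ => (hg' v).differentiable (by simp) x
  rw [key u v, key v u]
  congr 2
  ext x
  have hd : DifferentiableAt ℝ (fderiv ℝ g) x :=
    (hg.fderiv_right (m := (⊤ : ℕ∞)) (by simp)).differentiable (by simp) x
  have e : ∀ u v, fderiv ℝ (fun y => fderiv ℝ g y v) x u = fderiv ℝ (fderiv ℝ g) x u v := by
    intro u v
    rw [fderiv_clm_apply hd (differentiableAt_const v)]
    simp
  rw [e, e, (hg.contDiffAt.isSymmSndFDerivAt (by
    rw [minSmoothness_of_isRCLikeNormedField]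
    exact WithTop.coe_le_coe.2 (le_top : (2 : ℕ∞) ≤ ⊤))).eq]

/-- Exchanging derivatives turns `∫ ∂ⱼφᵢ ∂ᵢφⱼ` into `∫ ∂ᵢφᵢ ∂ⱼφⱼ`, so the integral equals `∫ (div
φ)²`. The exchange takes place on the whole space, as `∇φ` vanishes off `Ω`. -/
lemma integral_sum_classicalGrad_mul_swap_nonneg {φ : Vec d → Vec d} (hφ : IsTest Ω φ) :
    0 ≤ ∫ x in Ω, ∑ p : Fin d × Fin d, classicalGrad φ x p * classicalGrad φ x p.swap := by
  have hcomp : ∀ i, ContDiff ℝ (⊤ : ℕ∞) fun x => φ x i := fun i =>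
    (EuclideanSpace.proj (𝕜 := ℝ) i).contDiff.comp hφ.1
  have hsupp : ∀ i, HasCompactSupport fun x => φ x i := fun i =>
    hφ.2.1.comp_left (g := fun y : Vec d => y i) rfl
  have hgrad : ∀ x p, classicalGrad φ x p =
      fderiv ℝ (fun y => φ y p.1) x (EuclideanSpace.single p.2 1) := by
    intro x p
    have h : HasFDerivAt (fun y => φ y p.1)
        ((EuclideanSpace.proj (𝕜 := ℝ) p.1).comp (fderiv ℝ φ x)) x :=
      (EuclideanSpace.proj (𝕜 := ℝ) p.1).hasFDerivAt.comp x
        (hφ.1.differentiable (by simp) x).hasFDerivAt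
    rw [h.fderiv]
    rfl
  have hint : ∀ p q : Fin d × Fin d,
      Integrable fun x => classicalGrad φ x p * classicalGrad φ x q := by
    intro p q
    simp only [hgrad]
    exact ((((hcomp p.1).continuous_fderiv (by simp)).clm_apply continuous_const).mul
      (((hcomp q.1).continuous_fderiv (by simp)).clm_apply
        continuous_const)).integrable_of_hasCompactSupport
      ((hsupp p.1).fderiv_apply (𝕜 := ℝ) _).mul_right
  rw [setIntegral_eq_integral_of_forall_compl_eq_zero, integral_finsetSum _ fun p _ => hint p p.swap]
  · have hpt : ∀ p : Fin d × Fin d, ∫ x, classicalGrad φ x p * classicalGrad φ x p.swap =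
        ∫ x, classicalGrad φ x (p.1, p.1) * classicalGrad φ x (p.2, p.2) := by
      intro p
      simp only [hgrad, Prod.fst_swap, Prod.snd_swap]
      exact integral_fderiv_mul_fderiv_comm (hcomp p.1) (hsupp p.1) (hcomp p.2) _ _
    rw [Finset.sum_congr rfl fun p _ => hpt p,
      ← integral_finsetSum _ fun (p : Fin d × Fin d) _ => hint (p.1, p.1) (p.2, p.2)]
    refine integral_nonneg fun x => ?_
    rw [Fintype.sum_prod_type, ← Fintype.sum_mul_sum (fun i => classicalGrad φ x (i, i))
      (fun i => classicalGrad φ x (i, i))]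
    exact mul_self_nonneg _
  · intro x hx
    have h0 : fderiv ℝ φ x = 0 :=
      fderiv_of_notMem_tsupport ℝ fun h => hx (hφ.2.2 h)
    simp [classicalGrad, h0]

lemma norm_sq_eq_integral {α E : Type*} [MeasurableSpace α] {μ : Measure α}
    [NormedAddCommGroup E] [InnerProductSpace ℝ E] (f : Lp E 2 μ) :
    ‖f‖ ^ 2 = ∫ x, ‖f x‖ ^ 2 ∂μ := by
  rw [← real_inner_self_eq_norm_sq, L2.inner_def]
  simp only [real_inner_self_eq_norm_sq]

lemma norm_sq_symL_compLp (G : Lp (Mat d) 2 (volume.restrict Ω)) :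
    ‖(symL d).compLpL 2 (volume.restrict Ω) G‖ ^ 2 = ∫ x in Ω, ‖sym (G x)‖ ^ 2 := by
  rw [norm_sq_eq_integral]
  refine integral_congr_ae ?_
  filter_upwards [(symL d).coeFn_compLpL (p := 2) (μ := volume.restrict Ω) G] with x hx
  rw [hx, symL_apply]

/-- Korn's inequality `‖∇v‖² ≤ 2 ‖Dv‖²` on `W_0^{1,2}(Ω)^d`. -/
lemma norm_sq_grad_le_of_mem_sobolevZero {w : Pair Ω} (hw : w ∈ sobolevZero Ω) :
    ‖w.2‖ ^ 2 ≤ 2 * ∫ x in Ω, ‖sym (w.2 x)‖ ^ 2 := by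
  rw [← norm_sq_symL_compLp]
  -- The symmetric part acts as a bounded operator on `L²`, so the inequality passes from test
  -- functions to their closure.
  have hcl : IsClosed {w : Pair Ω |
      ‖w.2‖ ^ 2 ≤ 2 * ‖(symL d).compLpL 2 (volume.restrict Ω) w.2‖ ^ 2} :=
    isClosed_le (by fun_prop) (by fun_prop)
  have hw' : w ∈ closure (testPairs Ω : Set (Pair Ω)) := hw.2
  refine closure_minimal ?_ hcl hw'
  rintro w ⟨φ, hφ, -, h2⟩
  have h := integral_sum_classicalGrad_mul_swap_nonneg hφ
  have e : ∫ x in Ω, ∑ p : Fin d × Fin d, classicalGrad φ x p * classicalGrad φ x p.swap =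
      2 * ‖(symL d).compLpL 2 (volume.restrict Ω) w.2‖ ^ 2 - ‖w.2‖ ^ 2 := by
    rw [norm_sq_symL_compLp, norm_sq_eq_integral, ← integral_const_mul, ← integral_sub]
    · refine integral_congr_ae ?_
      filter_upwards [h2] with x hx
      rw [← hx, sum_mul_swap_eq]
    · exact (((symL d).comp_memLp' (Lp.memLp w.2)).integrable_norm_pow two_ne_zero).const_mul 2
    · exact (Lp.memLp w.2).integrable_norm_pow two_ne_zero
  rw [e] at h
  exact sub_nonneg.1 h

/-! ### Transfer of the abstract iteration to the discrete problem -/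

lemma memLp_sym (G : Lp (Mat d) 2 (volume.restrict Ω)) :
    MemLp (fun x => sym (G x)) 2 (volume.restrict Ω) :=
  (symL d).comp_memLp' (Lp.memLp G)

lemma sym_sub_ae (V W : Pair Ω) :
    (fun x => sym ((V - W).2 x)) =ᵐ[volume.restrict Ω]
      (fun x => sym (V.2 x)) - fun x => sym (W.2 x) := by
  filter_upwards [Lp.coeFn_sub V.2 W.2] with x hx
  have hx' : (V - W).2 x = V.2 x - W.2 x := hx
  rw [hx', sym_sub]
  rfl

lemma formA_eq_viscForm (σ ν : ℝ) (n : ℕ) (U V W : Pair Ω) :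
    formA σ ν n U V W = viscForm (volume.restrict Ω) σ ν ((n : ℝ) ^ 2)⁻¹
      (fun x => sym (U.2 x)) (fun x => sym (V.2 x)) (fun x => sym (W.2 x)) := rfl

lemma formA_sub_right_eq (σ ν : ℝ) (n : ℕ) (U V W R : Pair Ω) :
    formA σ ν n U V (W - R) = viscForm (volume.restrict Ω) σ ν ((n : ℝ) ^ 2)⁻¹
      (fun x => sym (U.2 x)) (fun x => sym (V.2 x))
      ((fun x => sym (W.2 x)) - fun x => sym (R.2 x)) := by
  rw [formA_eq_viscForm, viscForm, viscForm]
  refine integral_congr_ae ?_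
  filter_upwards [sym_sub_ae W R] with x hx
  rw [hx]

lemma integral_norm_sq_sym_sub (V W : Pair Ω) :
    ∫ x in Ω, ‖sym ((V - W).2 x)‖ ^ 2 =
      ∫ x in Ω, ‖((fun x => sym (W.2 x)) - fun x => sym (V.2 x)) x‖ ^ 2 := by
  refine integral_congr_ae ?_
  filter_upwards [sym_sub_ae V W] with x hx
  simp only [hx, Pi.sub_apply, norm_sub_rev]

lemma integrable_mul_tr (hΩ : volume Ω ≠ ⊤) (Q : LInf Ω) (V : Pair Ω) :
    Integrable (fun x => Q x * tr (V.2 x)) (volume.restrict Ω) := by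
  have : IsFiniteMeasure (volume.restrict Ω) := ⟨by simpa using hΩ.lt_top⟩
  have h : MemLp (fun x => tr (V.2 x)) 2 (volume.restrict Ω) :=
    (trL d).comp_memLp' (Lp.memLp V.2)
  exact (h.integrable one_le_two).mul_of_top_right (Lp.memLp Q)

lemma formB_sub_right (hΩ : volume Ω ≠ ⊤) (Q : LInf Ω) (V W : Pair Ω) :
    formB Q (V - W) = formB Q V - formB Q W := by
  have h : ∫ x in Ω, Q x * tr ((V - W).2 x) =
      (∫ x in Ω, Q x * tr (V.2 x)) - ∫ x in Ω, Q x * tr (W.2 x) := by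
    rw [← integral_sub (integrable_mul_tr hΩ Q V) (integrable_mul_tr hΩ Q W)]
    refine integral_congr_ae ?_
    filter_upwards [Lp.coeFn_sub V.2 W.2] with x hx
    have hx' : (V - W).2 x = V.2 x - W.2 x := hx
    rw [hx', ← trL_apply, map_sub, mul_sub]
    rfl
  rw [formB, formB, formB, h]
  ring

lemma formB_zero_left (V : Pair Ω) : formB 0 V = 0 := by
  have h : ∫ x in Ω, (0 : LInf Ω) x * tr (V.2 x) = ∫ x in Ω, (0 : ℝ) := by
    refine integral_congr_ae ?_
    filter_upwards [Lp.coeFn_zero ℝ ⊤ (volume.restrict Ω)] with x hx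
    have hx' : ((0 : LInf Ω) : Vec d → ℝ) x = 0 := hx
    rw [hx', zero_mul]
  rw [formB, h, integral_zero, neg_zero]

variable {T : Geometry.SimplicialComplex ℝ (Vec d)}
  {PV : Finset (Vec d) → Submodule ℝ (Fin d → MvPolynomial (Fin d) ℝ)}
  {PQ : Finset (Vec d) → Submodule ℝ (MvPolynomial (Fin d) ℝ)}
  {σ ν : ℝ} {n : ℕ} {f : L2Vec Ω}

lemma SolvesFrozen.eq_load {W U : Pair Ω} {P : LInf Ω}
    (h : SolvesFrozen Ω T PV PQ σ ν n f W U P) {V : Pair Ω} (hV : V ∈ velocitySpace Ω T PV) :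
    formA σ ν n W U V + formB P V = load f V := by
  have := h.2.2 V hV 0 (zero_mem _)
  rwa [formB_zero_left, add_zero] at this

/-- The discrete velocity is discretely divergence free. -/
lemma SolvesFrozen.formB_eq_zero {W U : Pair Ω} {P : LInf Ω}
    (h : SolvesFrozen Ω T PV PQ σ ν n f W U P) {Q : LInf Ω} (hQ : Q ∈ pressureSpace Ω T PQ) :
    formB Q U = 0 := by
  have h1 := h.2.2 U h.1 Q hQ
  have h2 := h.eq_load h.1
  linarith

/-- Differences of discrete velocities are discretely divergence free, so both pressures drop out
and both forms equal the same load. -/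
lemma SolvesFrozen.formA_sub_eq (hΩ : volume Ω ≠ ⊤) {W W₁ W₂ W₃ U U₁ U₂ : Pair Ω}
    {P P₁ P₂ P₃ : LInf Ω} {U₃ : Pair Ω}
    (h : SolvesFrozen Ω T PV PQ σ ν n f W U P) (h₁ : SolvesFrozen Ω T PV PQ σ ν n f W₁ U₁ P₁)
    (h₂ : SolvesFrozen Ω T PV PQ σ ν n f W₂ U₂ P₂)
    (h₃ : SolvesFrozen Ω T PV PQ σ ν n f W₃ U₃ P₃) :
    formA σ ν n W U (U₂ - U₃) = formA σ ν n W₁ U₁ (U₂ - U₃) := by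
  have hV : U₂ - U₃ ∈ velocitySpace Ω T PV := sub_mem h₂.1 h₃.1
  have hB : ∀ Q ∈ pressureSpace Ω T PQ, formB Q (U₂ - U₃) = 0 := fun Q hQ => by
    rw [formB_sub_right hΩ, h₂.formB_eq_zero hQ, h₃.formB_eq_zero hQ, sub_zero]
  have e := (h.eq_load hV).trans (h₁.eq_load hV).symm
  rwa [hB P h.2.1.1, hB P₁ h₁.2.1.1, add_zero, add_zero] at e

lemma norm12_sq_kacanov_le (hΩ : volume Ω ≠ ⊤) (hσ : 0 ≤ σ) (hν : 0 < ν) (hn : 1 ≤ n)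
    {U : Pair Ω} {P : LInf Ω} (hU : IsDiscreteSolution Ω T PV PQ σ ν n f U P)
    {Uℓ : ℕ → Pair Ω} {Pℓ : ℕ → LInf Ω} (hUℓ : IsKacanovSequence Ω T PV PQ σ ν n f Uℓ Pℓ)
    (ℓ : ℕ) :
    norm12 (U - Uℓ ℓ) ^ 2 ≤
      (σ * n + 2 * ν) / ν * (σ * n / (σ * n + 2 * ν)) ^ ℓ * norm12 (U - Uℓ 0) ^ 2 := by
  have : IsFiniteMeasure (volume.restrict Ω) := ⟨by simpa using hΩ.lt_top⟩
  have hn0 : (0 : ℝ) < n := by exact_mod_cast hn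
  have hmem : ∀ ℓ, Uℓ ℓ ∈ velocitySpace Ω T PV := fun ℓ => by
    rcases ℓ with _ | ℓ
    exacts [hUℓ.1, (hUℓ.2 ℓ).1]
  -- Equality holds: `s = σ n` is the sharp bound for `c = n⁻²`.
  have hs : σ ≤ σ * n * Real.sqrt ((n : ℝ) ^ 2)⁻¹ := by
    rw [Real.sqrt_inv, Real.sqrt_sq hn0.le, mul_assoc, mul_inv_cancel₀ hn0.ne', mul_one]
  have key := integral_norm_sub_sq_kacanov_le (μ := volume.restrict Ω) (c := ((n : ℝ) ^ 2)⁻¹)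
    hσ hν (by positivity) (by positivity) hs (memLp_sym U.2)
    (Sℓ := fun ℓ x => sym ((Uℓ ℓ).2 x)) (fun ℓ => memLp_sym (Uℓ ℓ).2)
    (fun ℓ k => by
      rw [← formA_sub_right_eq, ← formA_sub_right_eq]
      exact (hUℓ.2 ℓ).formA_sub_eq hΩ hU (hUℓ.2 k) hU) ℓ
  rw [← integral_norm_sq_sym_sub, ← integral_norm_sq_sym_sub] at key
  have hkorn := norm_sq_grad_le_of_mem_sobolevZero (sub_mem hU.1 (hmem ℓ)).1
  have h0 : ∫ x in Ω, ‖sym ((U - Uℓ 0).2 x)‖ ^ 2 ≤ norm12 (U - Uℓ 0) ^ 2 := by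
    rw [norm12, norm_sq_eq_integral]
    exact integral_mono (integrable_norm_sq (memLp_sym _)) (integrable_norm_sq (Lp.memLp _))
      fun x => pow_le_pow_left₀ (norm_nonneg _) (norm_sym_le _) 2
  -- Korn's constant `2` cancels the `2` in the denominator `2ν`; the initial error costs nothing
  -- since `|sym G| ≤ |G|`.
  calc norm12 (U - Uℓ ℓ) ^ 2
      ≤ 2 * ((σ * n + 2 * ν) / (2 * ν) * (σ * n / (σ * n + 2 * ν)) ^ ℓ *
          norm12 (U - Uℓ 0) ^ 2) :=
        hkorn.trans (mul_le_mul_of_nonneg_left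
          (key.trans (mul_le_mul_of_nonneg_left h0 (by positivity))) zero_le_two)
    _ = _ := by field_simp

/-! ### Comparison with the stated contraction factor -/

lemma contraction_quotient_bounds {s r ν : ℝ} (hν : 0 < ν) (hs : 0 ≤ s) (hr : 0 ≤ r) :
    0 < ν ^ 3 / ((r + 2 * ν) * (s + 2 * ν) ^ 2) ∧
      ν ^ 3 / ((r + 2 * ν) * (s + 2 * ν) ^ 2) < 1 ∧
      s / (s + 2 * ν) ≤ 1 - ν ^ 3 / ((r + 2 * ν) * (s + 2 * ν) ^ 2) := by
  have h1 : 2 * ν ≤ r + 2 * ν := by linarith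
  have h2 : 2 * ν ≤ s + 2 * ν := by linarith
  have hp : 0 < s + 2 * ν := by positivity
  have h3 : (2 * ν) * (2 * ν) ≤ (r + 2 * ν) * (s + 2 * ν) :=
    mul_le_mul h1 h2 (by positivity) (by positivity)
  -- The right side is half of `1 - s / (s + 2ν)`, so this one bound gives both remaining claims.
  have h4 : ν ^ 3 / ((r + 2 * ν) * (s + 2 * ν) ^ 2) ≤ ν / (s + 2 * ν) := by
    rw [div_le_div_iff₀ (by positivity) hp]
    have := mul_le_mul_of_nonneg_left h3 (show 0 ≤ ν * (s + 2 * ν) by positivity)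
    nlinarith [mul_pos (pow_pos hν 3) hp]
  have h5 : s / (s + 2 * ν) + 2 * (ν / (s + 2 * ν)) = 1 := by field_simp
  have h6 : 0 < ν / (s + 2 * ν) := by positivity
  have h7 : 0 ≤ s / (s + 2 * ν) := by positivity
  exact ⟨by positivity, by linarith, by linarith⟩

lemma qCon_bounds (hσ : 0 ≤ σ) (hν : 0 < ν) :
    0 < qCon σ ν n ∧ qCon σ ν n < 1 ∧ σ * n / (σ * n + 2 * ν) ≤ qCon σ ν n := by
  obtain ⟨h1, h2, h3⟩ := contraction_quotient_bounds (s := σ * n) (r := Real.sqrt 3 * σ * n)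
    hν (by positivity) (by positivity)
  exact ⟨sub_pos.2 h2, sub_lt_self _ h1, h3⟩

end Sobolev

end KacanovFE

/-! ### The error bound and convergence -/

theorem mainTheorem4 (d : ℕ) (hd : d = 2 ∨ d = 3)
    (Ω : Set (KacanovFE.Vec d)) (hΩ : IsOpen Ω) (hΩb : Bornology.IsBounded Ω)
    (T : Geometry.SimplicialComplex ℝ (KacanovFE.Vec d)) (hT : KacanovFE.IsTriangulation Ω T)
    (iStar jStar : ℕ) (hij : jStar ≤ iStar)
    (PV : Finset (KacanovFE.Vec d) → Submodule ℝ (Fin d → MvPolynomial (Fin d) ℝ))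
    (hPV : ∀ K ∈ KacanovFE.elements T,
      KacanovFE.vecPolys d 1 ≤ PV K ∧ PV K ≤ KacanovFE.vecPolys d iStar)
    (PQ : Finset (KacanovFE.Vec d) → Submodule ℝ (MvPolynomial (Fin d) ℝ))
    (hPQ : ∀ K ∈ KacanovFE.elements T,
      KacanovFE.polys d 0 ≤ PQ K ∧ PQ K ≤ KacanovFE.polys d jStar)
    (σ ν : ℝ) (hσ : 0 ≤ σ) (hν : 0 < ν) (n : ℕ) (hn : 1 ≤ n)
    (f : KacanovFE.L2Vec Ω)
    (U : KacanovFE.Pair Ω) (P : KacanovFE.LInf Ω)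
    (hU : KacanovFE.IsDiscreteSolution Ω T PV PQ σ ν n f U P)
    (Uℓ : ℕ → KacanovFE.Pair Ω) (Pℓ : ℕ → KacanovFE.LInf Ω)
    (hUℓ : KacanovFE.IsKacanovSequence Ω T PV PQ σ ν n f Uℓ Pℓ) :
    (0 < KacanovFE.qCon σ ν n ∧ KacanovFE.qCon σ ν n < 1) ∧
    (∀ ℓ : ℕ, KacanovFE.norm12 (U - Uℓ ℓ) ≤
      Real.sqrt ((Real.sqrt 3 * σ * n + 2 * ν) / ν) *
        KacanovFE.qCon σ ν n ^ ((ℓ : ℝ) / 2) * KacanovFE.norm12 (U - Uℓ 0)) ∧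
    Filter.Tendsto (fun ℓ : ℕ => KacanovFE.norm12 (U - Uℓ ℓ)) Filter.atTop (nhds 0) := by
  obtain ⟨hq0, hq1, hqθ⟩ := KacanovFE.qCon_bounds (n := n) hσ hν
  set q := KacanovFE.qCon σ ν n
  have hrpow : ∀ ℓ : ℕ, q ^ ((ℓ : ℝ) / 2) = Real.sqrt q ^ ℓ := fun ℓ => by
    rw [Real.sqrt_eq_rpow, ← Real.rpow_natCast, ← Real.rpow_mul hq0.le]
    congr 1
    ring
  have hbound : ∀ ℓ : ℕ, KacanovFE.norm12 (U - Uℓ ℓ) ≤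
      Real.sqrt ((Real.sqrt 3 * σ * n + 2 * ν) / ν) * q ^ ((ℓ : ℝ) / 2) *
        KacanovFE.norm12 (U - Uℓ 0) := by
    intro ℓ
    have hN : 0 ≤ KacanovFE.norm12 (U - Uℓ 0) := norm_nonneg _
    rw [hrpow]
    refine abs_le_of_sq_le_sq' ?_ (by positivity) |>.2
    rw [mul_pow, mul_pow, Real.sq_sqrt (by positivity), ← pow_mul, mul_comm ℓ 2, pow_mul,
      Real.sq_sqrt hq0.le]
    refine (KacanovFE.norm12_sq_kacanov_le hΩb.measure_lt_top.ne hσ hν hn hU hUℓ ℓ).trans ?_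
    -- The squared estimate holds without `√3`; enlarging its prefactor and its rate to the stated
    -- values finishes the bound.
    have h3 : σ * n ≤ Real.sqrt 3 * σ * n := by
      rw [mul_assoc]
      exact le_mul_of_one_le_left (by positivity) (Real.one_le_sqrt.2 (by norm_num))
    gcongr
  refine ⟨⟨hq0, hq1⟩, hbound, ?_⟩
  have hsq : Real.sqrt q < 1 := by rw [Real.sqrt_lt' one_pos]; simpa using hq1
  have hlim := ((tendsto_pow_atTop_nhds_zero_of_lt_one (Real.sqrt_nonneg q) hsq).const_mul
    (Real.sqrt ((Real.sqrt 3 * σ * n + 2 * ν) / ν))).mul_const (KacanovFE.norm12 (U - Uℓ 0))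
  rw [mul_zero, zero_mul] at hlim
  refine squeeze_zero (fun ℓ => norm_nonneg _) (fun ℓ => ?_) hlim
  rw [← hrpow]
  exact hbound ℓ
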